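/- Let $n\ge 0$ be an integer and let $L$ be a set of $6n$ lines in the Euclidean plane $\mathbb{R}^2$, each colored with one of three colors, such that each color is used for the same number of lines (that is, for exactly $2n$ lines). Assume that the arrangement of $L$ is simple: no two distinct lines of $L$ are parallel, and no point of the plane lies on more than two lines of $L$. Then there is a non-degenerate closed segment, with neither endpoint on a line of $L$, that intersects exactly $n$ lines of each color. -/

import Mathlib

/-- The Euclidean plane. -/
abbrev Plane : Type := EuclideanSpace ℝ (Fin 2)

/-- A line in the plane: an affine subspace of dimension one. -/
def IsLine (l : AffineSubspace ℝ Plane) : Prop :=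
  Module.finrank ℝ l.direction = 1

/-- A finite set of lines induces a simple arrangement: no two distinct lines are parallel,
and no point lies on more than two of the lines. -/
def IsSimpleArrangement (L : Finset (AffineSubspace ℝ Plane)) : Prop :=
  (∀ l ∈ L, IsLine l) ∧
  (∀ l ∈ L, ∀ m ∈ L, l ≠ m → ¬ l.Parallel m) ∧
  (∀ p : Plane, {l : AffineSubspace ℝ Plane | l ∈ L ∧ p ∈ l}.ncard ≤ 2)

/-- The elements of `L` that have color `i`. -/
def colorClass {α : Type*} (L : Finset α) (color : α → Fin 3) (i : Fin 3) : Finset α :=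
  L.filter (fun l => color l = i)

/-- A `3`-colored finite set is balanced if it has the same number of elements of each color. -/
def IsBalanced {α : Type*} (L : Finset α) (color : α → Fin 3) : Prop :=
  ∀ i j : Fin 3, (colorClass L color i).card = (colorClass L color j).card

/-! ### Topological tools: forced zeros, continuous roots, rounding. -/

open Filter Topology

/-! Homogenise: a line becomes a linear form `N l` on ℝ³ and a point becomes a nonzero vector up to
sign. Two points bound two complementary projective segments; the lines crossing one of them are
those whose forms have opposite signs at the chosen end vectors. So it suffices to find `a`, `b` at
which exactly half of the `2n` forms of each color have opposite signs (`exists_half_neg_pairing`):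
whichever segment is the affine one, it meets `n` lines of each color.

To find them, replace signs by the continuous odd `truncation`, let `b` be a direction at infinity
and `a = u + t b` with `u ⊥ b`. The three correlations are nondecreasing in `t`. Solving for a root
of their slightly tilted sum eliminates `t` and leaves two functions on a square, odd under Klein
bottle identifications. They have a common zero (`exists_zero_of_antiperiodic`), and the third
correlation is then small too.

Correlations below 1 in absolute value can be rounded to exact halves
(`Finset.exists_half_of_abs_sum_lt_one`). General position, made uniform by compactness, realizes
the rounded signs by actual vectors (`exists_uniform_pos_mul_pairing`). -/

theorem Complex.eq_of_continuous_of_exp_eq {g : ℝ → ℂ} {c : ℂ} (hg : Continuous g)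
    (h : ∀ x, Complex.exp (g x) = c) (x y : ℝ) : g x = g y :=
  Complex.isCoveringMap_exp.const_of_comp hg (fun a b ↦ Subtype.ext ((h a).trans (h b).symm)) x y

/-- A map from the plane to `ℂ` which is antiperiodic in the first variable and, up to a
reflection of the first variable, in the second one, has a zero. -/
theorem exists_zero_of_antiperiodic {H : ℝ → ℝ → ℂ} {p : ℝ}
    (hc : Continuous fun z : ℝ × ℝ ↦ H z.1 z.2)
    (h₁ : ∀ y, H p y = -H 0 y) (h₂ : ∀ x, H x p = -H (p - x) 0) : ∃ x y, H x y = 0 := by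
  by_contra! hne
  have hU : IsSimplyConnected (Set.univ : Set (ℝ × ℝ)) := by
    have := (convex_univ (𝕜 := ℝ) (E := ℝ × ℝ)).contractibleSpace Set.univ_nonempty
    exact (inferInstance : SimplyConnectedSpace (Set.univ : Set (ℝ × ℝ)))
  -- A continuous logarithm `f` of `H`: its increments across the identified sides have exponential
  -- `-1`, hence are constant.
  obtain ⟨f, hf, hfe⟩ := Complex.exists_continuousOn_eqOn_exp_comp
    (X := ℝ × ℝ) (U := Set.univ) (g := fun z ↦ H z.1 z.2)
    hU isOpen_univ hc.continuousOn
    (by rintro ⟨z, -, hz⟩; exact hne _ _ hz)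
  rw [continuousOn_univ] at hf
  have hexp : ∀ x y, Complex.exp (f (x, y)) = H x y := fun x y ↦ hfe (Set.mem_univ (x, y))
  have hd := Complex.eq_of_continuous_of_exp_eq (g := fun y ↦ f (p, y) - f (0, y)) (c := -1)
    (by fun_prop) (fun y ↦ by
      rw [Complex.exp_sub, hexp, hexp, h₁, neg_div, div_self (hne _ _)]) p 0
  have he := Complex.eq_of_continuous_of_exp_eq (g := fun x ↦ f (x, p) - f (p - x, 0)) (c := -1)
    (by fun_prop) (fun x ↦ by
      rw [Complex.exp_sub, hexp, hexp, h₂, neg_div, div_self (hne _ _)]) p 0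
  -- The reflection makes the increments along the top and bottom sides opposite, while `hd` makes
  -- them equal.
  have hz : f (p, 0) - f (0, 0) = 0 := by
    simp only [sub_self, sub_zero] at he
    linear_combination (hd - he) * (-1 / 2)
  have h := h₁ 0
  rw [← hexp, ← hexp, sub_eq_zero.1 hz] at h
  exact Complex.exp_ne_zero _ (self_eq_neg.1 h)

/-- A uniformly strictly increasing function of one variable, depending continuously on a
parameter, has a zero depending continuously on the parameter. -/
theorem exists_continuous_root {P : Type*} [TopologicalSpace P] {Φ : ℝ → P → ℝ} {δ : ℝ}
    (hδ : 0 < δ) (hc : Continuous fun z : ℝ × P ↦ Φ z.1 z.2)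
    (hm : ∀ p s t, s ≤ t → δ * (t - s) ≤ Φ t p - Φ s p) :
    ∃ T : P → ℝ, Continuous T ∧ ∀ p t, Φ t p = 0 ↔ t = T p := by
  have hc₁ : ∀ p, Continuous fun t ↦ Φ t p := fun p ↦
    hc.comp (Continuous.prodMk continuous_id continuous_const)
  have hc₂ : ∀ t, Continuous fun p ↦ Φ t p := fun t ↦
    hc.comp (Continuous.prodMk continuous_const continuous_id)
  have hex : ∀ p, ∃ t, Φ t p = 0 := by
    intro p
    have hr : 0 ≤ |Φ 0 p| / δ := by positivity
    have hrδ : δ * (|Φ 0 p| / δ) = |Φ 0 p| := by field_simp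
    have h₁ := hm p 0 _ hr
    have h₂ := hm p (-(|Φ 0 p| / δ)) 0 (by linarith)
    have h₃ := neg_abs_le (Φ 0 p)
    have h₄ := le_abs_self (Φ 0 p)
    obtain ⟨t, -, ht⟩ := intermediate_value_Icc (a := -(|Φ 0 p| / δ)) (b := |Φ 0 p| / δ)
      (by linarith) (hc₁ p).continuousOn
      (show (0 : ℝ) ∈ _ from ⟨by linarith, by linarith⟩)
    exact ⟨t, ht⟩
  choose T hT using hex
  -- Gives uniqueness of the root and, with `s` a root at a nearby parameter, continuity.
  have hdist : ∀ p s, δ * |s - T p| ≤ |Φ s p| := by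
    intro p s
    rcases le_total s (T p) with h | h
    · have := hm p _ _ h
      rw [hT] at this
      rw [abs_of_nonpos (sub_nonpos.2 h)]
      linarith [neg_abs_le (Φ s p)]
    · have := hm p _ _ h
      rw [hT] at this
      rw [abs_of_nonneg (sub_nonneg.2 h)]
      linarith [le_abs_self (Φ s p)]
  refine ⟨T, ?_, fun p t ↦ ⟨fun h ↦ ?_, fun h ↦ h ▸ hT p⟩⟩
  · rw [continuous_iff_continuousAt]
    intro p
    rw [ContinuousAt, tendsto_iff_dist_tendsto_zero]
    have hlim : Tendsto (fun q ↦ |Φ (T p) q| / δ) (𝓝 p) (𝓝 0) := by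
      have : Continuous fun q ↦ |Φ (T p) q| / δ := ((hc₂ (T p)).abs).div_const δ
      simpa [hT] using this.tendsto p
    refine squeeze_zero (fun _ ↦ dist_nonneg) (fun q ↦ ?_) hlim
    rw [dist_comm, Real.dist_eq, le_div_iff₀ hδ, mul_comm]
    exact hdist q (T p)
  · have := hdist p t
    rw [h, abs_zero] at this
    have h' : |t - T p| ≤ 0 := by nlinarith [abs_nonneg (t - T p)]
    exact sub_eq_zero.1 (abs_nonpos_iff.1 h')

/-- Rounding numbers in `[-1, 1]` of small total sum to signs of sum zero. -/
theorem Finset.exists_half_of_abs_sum_lt_one {ι : Type*} {S : Finset ι} {n : ℕ}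
    (hS : S.card = 2 * n) {c : ι → ℝ} (hc : ∀ l ∈ S, |c l| ≤ 1) (hsum : |∑ l ∈ S, c l| < 1) :
    ∃ A ⊆ S, A.card = n ∧ ∀ l ∈ S, (c l = 1 → l ∈ A) ∧ (c l = -1 → l ∉ A) := by
  classical
  -- With `k` values equal to 1, the sum is at least `2k - 2n`. Applied to `c` and `-c`, this bounds
  -- both forced sets by `n`.
  have key : ∀ d : ι → ℝ, (∀ l ∈ S, -1 ≤ d l) → ∑ l ∈ S, d l < 1 →
      (S.filter fun l ↦ d l = 1).card ≤ n := by
    intro d hd hlt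
    have h : ∑ l ∈ S, ((if d l = 1 then (2 : ℝ) else 0) - 1) ≤ ∑ l ∈ S, d l := by
      refine Finset.sum_le_sum fun l hl ↦ ?_
      split_ifs with h
      · rw [h]; norm_num
      · linarith [hd l hl]
    rw [Finset.sum_sub_distrib, ← Finset.sum_filter] at h
    simp only [Finset.sum_const, nsmul_eq_mul, hS] at h
    push_cast at h
    have h' : ((S.filter fun l ↦ d l = 1).card : ℝ) < n + 1 := by linarith
    exact_mod_cast Nat.lt_succ_iff.1 (by exact_mod_cast h')
  have h₁ := key c (fun l hl ↦ (abs_le.1 (hc l hl)).1) (abs_lt.1 hsum).2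
  have h₂ := key (fun l ↦ -c l) (fun l hl ↦ by linarith [(abs_le.1 (hc l hl)).2]) (by
    rw [Finset.sum_neg_distrib]; linarith [(abs_lt.1 hsum).1])
  have h₃ := Finset.card_sdiff_add_card_eq_card
    (Finset.filter_subset (fun l ↦ -c l = 1) S)
  obtain ⟨A, hA₁, hA₂, hA⟩ := Finset.exists_subsuperset_card_eq
    (s := S.filter fun l ↦ c l = 1) (t := S \ S.filter fun l ↦ -c l = 1) (n := n)
    (by
      intro l hl
      simp only [Finset.mem_filter, Finset.mem_sdiff, not_and] at hl ⊢
      refine ⟨hl.1, fun _ h ↦ ?_⟩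
      rw [hl.2] at h
      norm_num at h) h₁ (by omega)
  refine ⟨A, hA₂.trans Finset.sdiff_subset, hA, fun l hl ↦ ⟨fun h ↦ ?_, fun h h' ↦ ?_⟩⟩
  · exact hA₁ (Finset.mem_filter.2 ⟨hl, h⟩)
  · exact (Finset.mem_sdiff.1 (hA₂ h')).2 (Finset.mem_filter.2 ⟨hl, by rw [h, neg_neg]⟩)

/-- The standard pairing on `ℝ³`. -/
def pairing (n v : ℝ × ℝ × ℝ) : ℝ := n.1 * v.1 + n.2.1 * v.2.1 + n.2.2 * v.2.2

theorem pairing_add (n v w : ℝ × ℝ × ℝ) : pairing n (v + w) = pairing n v + pairing n w := by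
  simp only [pairing, Prod.fst_add, Prod.snd_add]; ring

theorem pairing_smul (n v : ℝ × ℝ × ℝ) (t : ℝ) : pairing n (t • v) = t * pairing n v := by
  simp only [pairing, Prod.smul_fst, Prod.smul_snd, smul_eq_mul]; ring

theorem pairing_neg (n v : ℝ × ℝ × ℝ) : pairing n (-v) = -pairing n v := by
  simp only [pairing, Prod.fst_neg, Prod.snd_neg]; ring

theorem continuous_pairing (n : ℝ × ℝ × ℝ) : Continuous (pairing n) := by
  unfold pairing; fun_prop

/-- The correlation of two vectors with respect to a finite family of linear forms, after
applying `h` to the values of the forms. -/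
def correlation {ι : Type*} (h : ℝ → ℝ) (N : ι → ℝ × ℝ × ℝ) (S : Finset ι)
    (a b : ℝ × ℝ × ℝ) : ℝ :=
  ∑ l ∈ S, h (pairing (N l) a) * h (pairing (N l) b)

/-! ### Making three correlations small simultaneously. -/

section correlation

variable {ι : Type*} {h : ℝ → ℝ} {N : ι → ℝ × ℝ × ℝ} {S : Finset ι}

theorem correlation_neg_left (ho : ∀ s, h (-s) = -h s) (a b : ℝ × ℝ × ℝ) :
    correlation h N S (-a) b = -correlation h N S a b := by
  simp [correlation, pairing_neg, ho]

theorem correlation_neg_right (ho : ∀ s, h (-s) = -h s) (a b : ℝ × ℝ × ℝ) :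
    correlation h N S a (-b) = -correlation h N S a b := by
  simp [correlation, pairing_neg, ho]

theorem continuous_correlation (hc : Continuous h) :
    Continuous fun z : (ℝ × ℝ × ℝ) × (ℝ × ℝ × ℝ) ↦ correlation h N S z.1 z.2 := by
  unfold correlation
  refine continuous_finsetSum _ fun l _ ↦ ?_
  exact (hc.comp ((continuous_pairing _).comp continuous_fst)).mul
    (hc.comp ((continuous_pairing _).comp continuous_snd))

theorem correlation_mono (hm : Monotone h) (ho : ∀ s, h (-s) = -h s) (u b : ℝ × ℝ × ℝ) {s t : ℝ}
    (hst : s ≤ t) : correlation h N S (u + s • b) b ≤ correlation h N S (u + t • b) b := by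
  have h0 : h 0 = 0 := by have := ho 0; rw [neg_zero] at this; linarith
  refine Finset.sum_le_sum fun l _ ↦ ?_
  simp only [pairing_add, pairing_smul]
  rcases le_total 0 (pairing (N l) b) with hb | hb
  · exact mul_le_mul_of_nonneg_right (hm (by nlinarith)) (h0 ▸ hm hb)
  · exact mul_le_mul_of_nonpos_right (hm (by nlinarith)) (h0 ▸ hm hb)

/-- With `s = N u`, `c = N b` and `h c = ρ c`, each term is `ρ ((s + tc) h (s + tc) - s h (s +
tc))`; the first product is nonnegative and the second at most `K`. The bound is uniform in `t`,
which controls the third correlation. -/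
theorem neg_le_mul_correlation (hm : Monotone h) (ho : ∀ s, h (-s) = -h s) (h1 : ∀ s, |h s| ≤ 1)
    {C K : ℝ} (hC : ∀ c, ∃ ρ, 0 ≤ ρ ∧ ρ ≤ C ∧ h c = ρ * c) {u : ℝ × ℝ × ℝ}
    (hK : ∀ l ∈ S, |pairing (N l) u| ≤ K) (b : ℝ × ℝ × ℝ) (t : ℝ) :
    -(S.card * (C * K)) ≤ t * correlation h N S (u + t • b) b := by
  have h0 : h 0 = 0 := by have := ho 0; rw [neg_zero] at this; linarith
  rw [correlation, Finset.mul_sum, ← nsmul_eq_mul, ← smul_neg]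
  refine Finset.card_nsmul_le_sum _ _ _ fun l hl ↦ ?_
  rw [pairing_add, pairing_smul]
  have hK := hK l hl
  obtain ⟨ρ, hρ, hρC, hρh⟩ := hC (pairing (N l) b)
  rw [hρh]
  set s := pairing (N l) u
  set c := pairing (N l) b
  have hy : 0 ≤ (s + t * c) * h (s + t * c) := by
    rcases le_total 0 (s + t * c) with hb | hb
    · exact mul_nonneg hb (h0 ▸ hm hb)
    · exact mul_nonneg_of_nonpos_of_nonpos hb (h0 ▸ hm hb)
  have hs : s * h (s + t * c) ≤ K := by
    refine (le_abs_self _).trans ?_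
    rw [abs_mul]
    calc _ ≤ |s| * 1 := mul_le_mul_of_nonneg_left (h1 _) (abs_nonneg _)
      _ ≤ K := by rwa [mul_one]
  have hK0 : 0 ≤ K := (abs_nonneg _).trans hK
  calc -(C * K) ≤ -(ρ * K) := neg_le_neg (mul_le_mul_of_nonneg_right hρC hK0)
    _ ≤ ρ * ((s + t * c) * h (s + t * c) - s * h (s + t * c)) := by nlinarith
    _ = _ := by ring

theorem abs_pairing_le (n v : ℝ × ℝ × ℝ) (h₁ : |v.1| ≤ 1) (h₂ : |v.2.1| ≤ 1) (h₃ : |v.2.2| ≤ 1) :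
    |pairing n v| ≤ |n.1| + |n.2.1| + |n.2.2| := by
  unfold pairing
  refine (abs_add_three _ _ _).trans ?_
  simp only [abs_mul]
  gcongr <;> exact mul_le_of_le_one_right (abs_nonneg _) ‹_›

/-- Three functions of a real variable `t` and of a point of the plane, which are increasing in
`t` and odd along the identifications of a square, have nearly a common zero. -/
theorem exists_abs_lt_one_of_odd {F : Fin 3 → ℝ → ℝ × ℝ → ℝ} {p M : ℝ}
    (hFc : ∀ i, Continuous fun z : ℝ × ℝ × ℝ ↦ F i z.1 z.2)
    (hm : ∀ i q s t, s ≤ t → F i s q ≤ F i t q)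
    (hF₁ : ∀ i t θ, F i (-t) (p, θ) = -F i t (0, θ))
    (hF₂ : ∀ i t x, F i (-t) (x, p) = -F i t (p - x, 0))
    (hlow : ∀ q t, -M ≤ t * ∑ i, F i t q) :
    ∃ t q, ∀ i, |F i t q| < 1 := by
  obtain ⟨δ, hδ, hδM⟩ : ∃ δ : ℝ, 0 < δ ∧ δ * M < 1 := by
    refine ⟨1 / (|M| + 1), by positivity, ?_⟩
    rw [one_div, inv_mul_lt_one₀ (by positivity)]
    linarith [le_abs_self M]
  have hΦ : Continuous fun z : ℝ × ℝ × ℝ ↦ ∑ i, F i z.1 z.2 + δ * z.1 :=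
    (continuous_finsetSum _ fun i _ ↦ hFc i).add (continuous_const.mul continuous_fst)
  -- The tilt `δ * t` makes the sum strictly increasing and preserves oddness, so the root `T` is
  -- odd as well.
  obtain ⟨T, hT, hTr⟩ := exists_continuous_root (Φ := fun t p ↦ ∑ i, F i t p + δ * t) hδ hΦ (by
      intro q s t hst
      have : ∑ i, F i s q ≤ ∑ i, F i t q :=
        Finset.sum_le_sum fun i _ ↦ hm i q s t hst
      linarith)
  have hT₀ : ∀ q, ∑ i, F i (T q) q + δ * T q = 0 := fun q ↦ (hTr q _).2 rfl
  have hT₁ : ∀ θ, T (p, θ) = -T (0, θ) := fun θ ↦ by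
    refine ((hTr _ _).1 ?_).symm
    simp only [hF₁, Finset.sum_neg_distrib]
    linarith [hT₀ (0, θ)]
  have hT₂ : ∀ x, T (x, p) = -T (p - x, 0) := fun x ↦ by
    refine ((hTr _ _).1 ?_).symm
    simp only [hF₂, Finset.sum_neg_distrib]
    linarith [hT₀ (p - x, 0)]
  have hFT : ∀ i, Continuous fun p : ℝ × ℝ ↦ F i (T p) p := fun i ↦
    (hFc i).comp (hT.prodMk continuous_id)
  obtain ⟨x, θ, hxθ⟩ := exists_zero_of_antiperiodic
    (H := fun x θ ↦ (F 0 (T (x, θ)) (x, θ) : ℂ) + F 1 (T (x, θ)) (x, θ) * Complex.I)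
    (p := p)
    ((Complex.continuous_ofReal.comp (hFT 0)).add
      ((Complex.continuous_ofReal.comp (hFT 1)).mul continuous_const))
    (fun θ ↦ by simp only [hT₁, hF₁]; push_cast; ring)
    (fun x ↦ by simp only [hT₂, hF₂]; push_cast; ring)
  have e₀ : F 0 (T (x, θ)) (x, θ) = 0 := by simpa using congrArg Complex.re hxθ
  have e₁ : F 1 (T (x, θ)) (x, θ) = 0 := by simpa using congrArg Complex.im hxθ
  have e₂ := hT₀ (x, θ)
  have e₃ := hlow (x, θ) (T (x, θ))
  rw [Fin.sum_univ_three, e₀, e₁, zero_add, zero_add] at e₂ e₃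
  refine ⟨T (x, θ), (x, θ), fun i ↦ ?_⟩
  fin_cases i
  · exact (congrArg abs e₀).trans_lt (by simp)
  · exact (congrArg abs e₁).trans_lt (by simp)
  · have h₂ : F 2 (T (x, θ)) (x, θ) = -(δ * T (x, θ)) := by linarith
    -- Here `F 2 = -δ T` and `T * F 2 ≥ -M`, so its square is at most `δ M < 1`.
    refine (sq_lt_one_iff_abs_lt_one (F 2 (T (x, θ)) (x, θ))).1 ?_
    rw [h₂] at e₃ ⊢
    nlinarith [mul_le_mul_of_nonneg_left e₃ hδ.le]

/-- For three finite families of linear forms on `ℝ³`, there are two nonzero vectors whose three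
correlations are all small. -/
theorem exists_correlation_lt_one (hc : Continuous h) (hm : Monotone h) (ho : ∀ s, h (-s) = -h s)
    (h1 : ∀ s, |h s| ≤ 1) {C : ℝ} (hC : ∀ c, ∃ ρ, 0 ≤ ρ ∧ ρ ≤ C ∧ h c = ρ * c)
    (N : ι → ℝ × ℝ × ℝ) (S : Fin 3 → Finset ι) :
    ∃ a b : ℝ × ℝ × ℝ, 1 ≤ a.1 ^ 2 + a.2.1 ^ 2 + a.2.2 ^ 2 ∧ 1 ≤ b.1 ^ 2 + b.2.1 ^ 2 + b.2.2 ^ 2 ∧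
      ∀ i, |correlation h N (S i) a b| < 1 := by
  classical
  -- `B θ` runs over directions at infinity and `U x θ` over the unit circle orthogonal to `B θ`.
  let B : ℝ → ℝ × ℝ × ℝ := fun θ ↦ (Real.cos θ, Real.sin θ, 0)
  let U : ℝ → ℝ → ℝ × ℝ × ℝ := fun x θ ↦
    (-(Real.cos x * Real.sin θ), Real.cos x * Real.cos θ, Real.sin x)
  let F : Fin 3 → ℝ → ℝ × ℝ → ℝ := fun i t p ↦
    correlation h N (S i) (U p.1 p.2 + t • B p.2) (B p.2)
  have hBpi : ∀ θ, B (θ + Real.pi) = -B θ := fun θ ↦ by simp [B, Real.cos_add_pi, Real.sin_add_pi]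
  have hUx : ∀ θ, U Real.pi θ = -U 0 θ := fun θ ↦ by simp [U]
  have hUθ : ∀ x, U x Real.pi = U (Real.pi - x) 0 := fun x ↦ by
    simp [U, Real.cos_pi_sub, Real.sin_pi_sub]
  have hB0 : B Real.pi = -B 0 := by simpa using hBpi 0
  have hFc : ∀ i, Continuous fun z : ℝ × ℝ × ℝ ↦ F i z.1 z.2 := by
    intro i
    have : Continuous fun z : ℝ × ℝ × ℝ ↦ (U z.2.1 z.2.2 + z.1 • B z.2.2, B z.2.2) := by
      simp only [U, B]; fun_prop
    exact (continuous_correlation (S := S i) (N := N) hc).comp this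
  have hF₁ : ∀ i t θ, F i (-t) (Real.pi, θ) = -F i t (0, θ) := by
    intro i t θ
    simp only [F, hUx]
    rw [neg_smul, ← neg_add, correlation_neg_left ho]
  have hF₂ : ∀ i t x, F i (-t) (x, Real.pi) = -F i t (Real.pi - x, 0) := by
    intro i t x
    simp only [F, hUθ, hB0]
    rw [smul_neg, neg_smul, neg_neg, correlation_neg_right ho]
  obtain ⟨K, hK⟩ : ∃ K : ℝ, ∀ i, ∀ l ∈ S i, ∀ p : ℝ × ℝ, |pairing (N l) (U p.1 p.2)| ≤ K := by
    refine ⟨∑ i, ∑ l ∈ S i, (|(N l).1| + |(N l).2.1| + |(N l).2.2|), fun i l hl p ↦ ?_⟩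
    refine (abs_pairing_le _ _ ?_ ?_ ?_).trans ?_
    · simp only [U, abs_neg, abs_mul]
      exact mul_le_one₀ (Real.abs_cos_le_one _) (abs_nonneg _) (Real.abs_sin_le_one _)
    · simp only [U, abs_mul]
      exact mul_le_one₀ (Real.abs_cos_le_one _) (abs_nonneg _) (Real.abs_cos_le_one _)
    · exact Real.abs_sin_le_one _
    · refine (Finset.single_le_sum (f := fun l ↦ |(N l).1| + |(N l).2.1| + |(N l).2.2|)
        (fun _ _ ↦ by positivity) hl).trans ?_
      exact Finset.single_le_sum
        (f := fun i ↦ ∑ l ∈ S i, (|(N l).1| + |(N l).2.1| + |(N l).2.2|))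
        (fun _ _ ↦ Finset.sum_nonneg fun _ _ ↦ by positivity) (Finset.mem_univ i)
  obtain ⟨M, hlow⟩ : ∃ M : ℝ, ∀ p t, -M ≤ t * ∑ i, F i t p := by
    refine ⟨∑ i, (S i).card * (C * K), fun p t ↦ ?_⟩
    rw [← Finset.sum_neg_distrib, Finset.mul_sum]
    exact Finset.sum_le_sum fun i _ ↦
      neg_le_mul_correlation hm ho h1 hC (fun l hl ↦ hK i l hl p) _ _
  obtain ⟨t, ⟨x, θ⟩, ht⟩ := exists_abs_lt_one_of_odd hFc
    (fun i q s t hst ↦ correlation_mono hm ho _ _ hst) hF₁ hF₂ hlow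
  refine ⟨U x θ + t • B θ, B θ, ?_, ?_, ht⟩
  · have h₁ := Real.sin_sq_add_cos_sq θ
    have h₂ := Real.sin_sq_add_cos_sq x
    have h₃ : (-(Real.cos x * Real.sin θ) + t * Real.cos θ) ^ 2
        + (Real.cos x * Real.cos θ + t * Real.sin θ) ^ 2 + Real.sin x ^ 2 = 1 + t ^ 2 := by
      linear_combination (Real.cos x ^ 2 + t ^ 2) * h₁ + h₂
    simp only [U, B, Prod.fst_add, Prod.snd_add, Prod.smul_fst, Prod.smul_snd, smul_eq_mul,
      mul_zero, add_zero]
    rw [h₃]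
    linarith [sq_nonneg t]
  · simp [B]

end correlation

/-! ### Realizing prescribed signs by vectors. -/

section realize

variable {ι : Type*} {N : ι → ℝ × ℝ × ℝ} {L : Finset ι}

theorem exists_pairing_eq
    (hdet : ∀ l ∈ L, ∀ m ∈ L, l ≠ m → (N l).1 * (N m).2.1 - (N m).1 * (N l).2.1 ≠ 0)
    (hN : ∀ l ∈ L, (N l).1 ^ 2 + (N l).2.1 ^ 2 ≠ 0) (hL : L.card ≤ 2) (τ : ι → ℝ) :
    ∃ w, ∀ l ∈ L, pairing (N l) w = τ l := by
  classical
  interval_cases hk : L.card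
  · rw [Finset.card_eq_zero] at hk
    exact ⟨0, by simp [hk]⟩
  · obtain ⟨l, rfl⟩ := Finset.card_eq_one.1 hk
    have h := hN l (Finset.mem_singleton_self l)
    refine ⟨((N l).1 * τ l / ((N l).1 ^ 2 + (N l).2.1 ^ 2),
      (N l).2.1 * τ l / ((N l).1 ^ 2 + (N l).2.1 ^ 2), 0), fun m hm ↦ ?_⟩
    rw [Finset.mem_singleton.1 hm]
    simp only [pairing]
    field_simp
    ring
  · obtain ⟨l, m, hlm, rfl⟩ := Finset.card_eq_two.1 hk
    have h := hdet l (by simp) m (by simp) hlm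
    obtain ⟨D, hD⟩ : ∃ D, D = (N l).1 * (N m).2.1 - (N m).1 * (N l).2.1 := ⟨_, rfl⟩
    rw [← hD] at h
    refine ⟨((τ l * (N m).2.1 - τ m * (N l).2.1) / D,
      ((N l).1 * τ m - (N m).1 * τ l) / D, 0), fun k hk ↦ ?_⟩
    simp only [Finset.mem_insert, Finset.mem_singleton] at hk
    rcases hk with rfl | rfl <;> simp only [pairing] <;> field_simp <;> rw [hD] <;> ring

theorem eventually_pos_mul_pairing {τ : ι → ℝ} {n : ι → ℝ × ℝ × ℝ} {l : ι} {v : ℝ × ℝ × ℝ}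
    (w : ℝ × ℝ × ℝ) (h : 0 < τ l * pairing (n l) v) :
    ∀ᶠ t : ℝ in 𝓝[>] 0, 0 < τ l * pairing (n l) (v + t • w) := by
  have hc : Continuous fun t : ℝ ↦ τ l * pairing (n l) (v + t • w) :=
    continuous_const.mul ((continuous_pairing _).comp (by fun_prop))
  have := hc.tendsto 0
  rw [zero_smul, add_zero] at this
  exact nhdsWithin_le_nhds (this.eventually_const_lt h)

/-- Sign conditions which hold at `v` for the forms not vanishing at `v` can be satisfied near `v`
by all forms, provided that at most two forms vanish at `v`. -/
theorem exists_pos_mul_pairing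
    (hdet : ∀ l ∈ L, ∀ m ∈ L, l ≠ m → (N l).1 * (N m).2.1 - (N m).1 * (N l).2.1 ≠ 0)
    (hN : ∀ l ∈ L, (N l).1 ^ 2 + (N l).2.1 ^ 2 ≠ 0) {v : ℝ × ℝ × ℝ}
    (hv : (L.filter fun l ↦ pairing (N l) v = 0).card ≤ 2) {τ : ι → ℝ} (hτ : ∀ l ∈ L, τ l ≠ 0)
    (h : ∀ l ∈ L, pairing (N l) v ≠ 0 → 0 < τ l * pairing (N l) v) :
    ∃ v', v'.2.2 ≠ 0 ∧ ∀ l ∈ L, 0 < τ l * pairing (N l) v' := by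
  classical
  have hsub := Finset.filter_subset (fun l ↦ pairing (N l) v = 0) L
  obtain ⟨w, hw⟩ := exists_pairing_eq (L := L.filter fun l ↦ pairing (N l) v = 0)
    (fun l hl m hm ↦ hdet l (hsub hl) m (hsub hm)) (fun l hl ↦ hN l (hsub hl)) hv τ
  have h₁ : ∀ᶠ t : ℝ in 𝓝[>] 0, ∀ l ∈ L, 0 < τ l * pairing (N l) (v + t • w) := by
    rw [Filter.eventually_all_finset]
    intro l hl
    by_cases h0 : pairing (N l) v = 0
    · filter_upwards [self_mem_nhdsWithin] with t (ht : 0 < t)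
      rw [pairing_add, pairing_smul, h0, hw l (Finset.mem_filter.2 ⟨hl, h0⟩), zero_add]
      have := mul_self_pos.2 (hτ l hl)
      nlinarith [mul_pos ht this]
    · exact eventually_pos_mul_pairing w (h l hl h0)
  obtain ⟨t, ht⟩ := h₁.exists
  -- A second perturbation moves the point off the line at infinity.
  have h₂ : ∀ᶠ s : ℝ in 𝓝[>] 0,
      ∀ l ∈ L, 0 < τ l * pairing (N l) (v + t • w + s • ((0, 0, 1) : ℝ × ℝ × ℝ)) := by
    rw [Filter.eventually_all_finset]
    exact fun l hl ↦ eventually_pos_mul_pairing _ (ht l hl)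
  have h₃ : ∀ᶠ s : ℝ in 𝓝[>] 0, s ≠ -(v + t • w).2.2 := by
    by_cases hz : -(v + t • w).2.2 = 0
    · rw [hz]
      filter_upwards [self_mem_nhdsWithin] with s (hs : 0 < s) using hs.ne'
    · exact nhdsWithin_le_nhds (isOpen_ne.mem_nhds (Ne.symm hz))
  obtain ⟨s, hs, hs'⟩ := (h₂.and h₃).exists
  refine ⟨_, fun h0 ↦ hs' ?_, hs⟩
  simp only [Prod.snd_add, Prod.smul_snd, smul_eq_mul, mul_one] at h0 ⊢
  linarith

/-- Uniform version of `exists_pos_mul_pairing`. -/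
theorem exists_uniform_pos_mul_pairing
    (hdet : ∀ l ∈ L, ∀ m ∈ L, l ≠ m → (N l).1 * (N m).2.1 - (N m).1 * (N l).2.1 ≠ 0)
    (hN : ∀ l ∈ L, (N l).1 ^ 2 + (N l).2.1 ^ 2 ≠ 0)
    (hL : ∀ v, v ≠ 0 → (L.filter fun l ↦ pairing (N l) v = 0).card ≤ 2) :
    ∃ ε > 0, ∀ v : ℝ × ℝ × ℝ, 1 ≤ v.1 ^ 2 + v.2.1 ^ 2 + v.2.2 ^ 2 → ∀ τ : ι → ℝ,
      (∀ l ∈ L, τ l ≠ 0) → (∀ l ∈ L, ε ≤ |pairing (N l) v| → 0 < τ l * pairing (N l) v) →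
      ∃ v', v'.2.2 ≠ 0 ∧ ∀ l ∈ L, 0 < τ l * pairing (N l) v' := by
  classical
  have hcpt : IsCompact {v : ℝ × ℝ × ℝ | v.1 ^ 2 + v.2.1 ^ 2 + v.2.2 ^ 2 = 1} := by
    refine Metric.isCompact_of_isClosed_isBounded
      (isClosed_eq (by fun_prop) continuous_const) ?_
    refine (Metric.isBounded_closedBall (x := (0 : ℝ × ℝ × ℝ)) (r := 1)).subset fun v hv ↦ ?_
    have hv : v.1 ^ 2 + v.2.1 ^ 2 + v.2.2 ^ 2 = 1 := hv
    rw [mem_closedBall_zero_iff, Prod.norm_def, Prod.norm_def]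
    simp only [Real.norm_eq_abs, sup_le_iff]
    refine ⟨?_, ?_, ?_⟩ <;> refine (sq_le_one_iff_abs_le_one _).1 ?_ <;>
      nlinarith [sq_nonneg v.1, sq_nonneg v.2.1, sq_nonneg v.2.2]
  have key : ∃ ε > 0, ∀ v ∈ {v : ℝ × ℝ × ℝ | v.1 ^ 2 + v.2.1 ^ 2 + v.2.2 ^ 2 = 1}, ∀ τ : ι → ℝ,
      (∀ l ∈ L, τ l ≠ 0) → (∀ l ∈ L, ε ≤ |pairing (N l) v| → 0 < τ l * pairing (N l) v) →
      ∃ v', v'.2.2 ≠ 0 ∧ ∀ l ∈ L, 0 < τ l * pairing (N l) v' := by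
    refine hcpt.induction_on (p := fun s ↦ ∃ ε > 0, ∀ v ∈ s, ∀ τ : ι → ℝ,
      (∀ l ∈ L, τ l ≠ 0) → (∀ l ∈ L, ε ≤ |pairing (N l) v| → 0 < τ l * pairing (N l) v) →
      ∃ v', v'.2.2 ≠ 0 ∧ ∀ l ∈ L, 0 < τ l * pairing (N l) v') ⟨1, one_pos, by simp⟩ ?_ ?_ ?_
    · rintro s t hst ⟨ε, hε, h⟩
      exact ⟨ε, hε, fun v hv ↦ h v (hst hv)⟩
    · rintro s t ⟨ε₁, hε₁, h₁⟩ ⟨ε₂, hε₂, h₂⟩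
      refine ⟨min ε₁ ε₂, lt_min hε₁ hε₂, fun v hv τ hτ h ↦ ?_⟩
      rcases hv with hv | hv
      · exact h₁ v hv τ hτ fun l hl hle ↦ h l hl ((min_le_left _ _).trans hle)
      · exact h₂ v hv τ hτ fun l hl hle ↦ h l hl ((min_le_right _ _).trans hle)
    · intro v₀ hv₀
      have hv₀' : v₀ ≠ 0 := by
        rintro rfl
        simp at hv₀
      obtain ⟨ε, hε, hε'⟩ : ∃ ε : ℝ, 0 < ε ∧
          ∀ l ∈ L, pairing (N l) v₀ ≠ 0 → ε < |pairing (N l) v₀| := by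
        have : ∀ᶠ ε : ℝ in 𝓝[>] 0,
            ∀ l ∈ L, pairing (N l) v₀ ≠ 0 → ε < |pairing (N l) v₀| := by
          rw [Filter.eventually_all_finset]
          intro l _
          by_cases h0 : pairing (N l) v₀ = 0
          · simp [h0]
          · filter_upwards [nhdsWithin_le_nhds (gt_mem_nhds (abs_pos.2 h0))] with ε h _ using h
        obtain ⟨ε, h₁, h₂⟩ := (this.and self_mem_nhdsWithin).exists
        exact ⟨ε, h₂, h₁⟩
      -- On this neighborhood, forms not vanishing at `v₀` keep their sign and exceed `ε`, so `τ` is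
      -- unconstrained only on the at most two forms vanishing at `v₀`.
      refine ⟨{v | ∀ l ∈ L, pairing (N l) v₀ ≠ 0 →
        ε < |pairing (N l) v| ∧ 0 < pairing (N l) v₀ * pairing (N l) v}, ?_, ε, hε, ?_⟩
      · refine nhdsWithin_le_nhds ?_
        change ∀ᶠ v in 𝓝 v₀, ∀ l ∈ L, _
        rw [Filter.eventually_all_finset]
        intro l hl
        by_cases h0 : pairing (N l) v₀ = 0
        · simp [h0]
        · have hc := continuous_pairing (N l)
          have h₁ := (hc.abs.tendsto v₀).eventually_const_lt (hε' l hl h0)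
          have h₂ := ((continuous_const.mul hc).tendsto v₀).eventually_const_lt
            (mul_self_pos.2 h0)
          filter_upwards [h₁, h₂] with v h₁ h₂ _ using ⟨h₁, h₂⟩
      · intro v hv τ hτ h
        refine exists_pos_mul_pairing hdet hN (hL v₀ hv₀') hτ fun l hl h0 ↦ ?_
        obtain ⟨h₁, h₂⟩ := hv l hl h0
        have h₃ := mul_pos (h l hl h₁.le) h₂
        have h₄ : 0 < (τ l * pairing (N l) v₀) * pairing (N l) v ^ 2 := by
          calc _ < _ := h₃
            _ = _ := by ring
        exact pos_of_mul_pos_left h₄ (sq_nonneg _)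
  obtain ⟨ε, hε, h⟩ := key
  refine ⟨ε, hε, fun v hv τ hτ hv' ↦ ?_⟩
  set r := √(v.1 ^ 2 + v.2.1 ^ 2 + v.2.2 ^ 2) with hr
  have hr1 : 1 ≤ r := Real.one_le_sqrt.2 hv
  have hr2 : r ^ 2 = v.1 ^ 2 + v.2.1 ^ 2 + v.2.2 ^ 2 := Real.sq_sqrt (by positivity)
  have hr0 : 0 < r := by linarith
  refine h (r⁻¹ • v) ?_ τ hτ fun l hl hle ↦ ?_
  · simp only [Set.mem_ofPred_eq, Prod.smul_fst, Prod.smul_snd, smul_eq_mul, mul_pow, ← mul_add,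
      ← hr2]
    field_simp
  · rw [pairing_smul] at hle ⊢
    have h₁ : r⁻¹ ≤ 1 := inv_le_one_of_one_le₀ hr1
    have h₂ : ε ≤ |pairing (N l) v| := by
      rw [abs_mul, abs_of_pos (inv_pos.2 hr0)] at hle
      exact hle.trans (mul_le_of_le_one_left (abs_nonneg _) h₁)
    have := mul_pos (inv_pos.2 hr0) (hv' l hl h₂)
    linarith

end realize

/-- Truncation to `[-1, 1]` after division by `ε`. -/
noncomputable def truncation (ε s : ℝ) : ℝ := max (-1) (min 1 (s / ε))

/-! ### The continuous substitute for the sign. -/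

section truncation

variable {ε : ℝ}

theorem continuous_truncation : Continuous (truncation ε) := by
  unfold truncation; fun_prop

theorem truncation_neg (s : ℝ) : truncation ε (-s) = -truncation ε s := by
  unfold truncation
  rw [← min_neg_neg, ← max_neg_neg, neg_neg, neg_div]
  rcases le_total (s / ε) 1 with h | h <;> rcases le_total (-1) (s / ε) with h' | h' <;>
    simp only [max_def, min_def] <;> split_ifs <;> linarith

theorem monotone_truncation (hε : 0 < ε) : Monotone (truncation ε) := fun _ _ hst ↦
  max_le_max le_rfl (min_le_min le_rfl (div_le_div_of_nonneg_right hst hε.le))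

theorem abs_truncation_le (s : ℝ) : |truncation ε s| ≤ 1 :=
  abs_le.2 ⟨le_max_left _ _, max_le (by norm_num) (min_le_left _ _)⟩

theorem truncation_of_le (hε : 0 < ε) {s : ℝ} (hs : ε ≤ s) : truncation ε s = 1 := by
  have : 1 ≤ s / ε := (one_le_div hε).2 hs
  rw [truncation, min_eq_left this, max_eq_right (by norm_num)]

theorem truncation_of_le_abs (hε : 0 < ε) {s : ℝ} (hs : ε ≤ |s|) :
    (truncation ε s = 1 ∧ 0 < s) ∨ (truncation ε s = -1 ∧ s < 0) := by
  rcases le_abs.1 hs with h | h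
  · exact .inl ⟨truncation_of_le hε h, hε.trans_le h⟩
  · refine .inr ⟨?_, by linarith⟩
    rw [← neg_neg s, truncation_neg, truncation_of_le hε h]

theorem exists_truncation_eq_mul (hε : 0 < ε) (c : ℝ) :
    ∃ ρ, 0 ≤ ρ ∧ ρ ≤ 1 / ε ∧ truncation ε c = ρ * c := by
  rcases le_or_gt ε |c| with h | h
  · have hc : 0 < |c| := hε.trans_le h
    refine ⟨1 / |c|, by positivity, one_div_le_one_div_of_le hε h, ?_⟩
    rcases truncation_of_le_abs hε h with ⟨h₁, h₂⟩ | ⟨h₁, h₂⟩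
    · rw [h₁, abs_of_pos h₂]
      field_simp
    · rw [h₁, abs_of_neg h₂, one_div_mul_eq_div, div_neg, div_self h₂.ne]
  · refine ⟨1 / ε, by positivity, le_rfl, ?_⟩
    obtain ⟨h₁, h₂⟩ := abs_lt.1 h
    rw [truncation, min_eq_right ((div_le_one hε).2 h₂.le), max_eq_right, one_div_mul_eq_div]
    rw [le_div_iff₀ hε]
    linarith

end truncation

/-- Given three families of `2 * n` linear forms on `ℝ³` in general position, there are two
vectors at which exactly half of the forms of every family have opposite signs. -/
theorem exists_half_neg_pairing {ι : Type*} {N : ι → ℝ × ℝ × ℝ} {L : Finset ι} {n : ℕ}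
    (color : ι → Fin 3) (hcard : ∀ i, (colorClass L color i).card = 2 * n)
    (hdet : ∀ l ∈ L, ∀ m ∈ L, l ≠ m → (N l).1 * (N m).2.1 - (N m).1 * (N l).2.1 ≠ 0)
    (hN : ∀ l ∈ L, (N l).1 ^ 2 + (N l).2.1 ^ 2 ≠ 0)
    (hL : ∀ v, v ≠ 0 → (L.filter fun l ↦ pairing (N l) v = 0).card ≤ 2) :
    ∃ a b : ℝ × ℝ × ℝ, a.2.2 ≠ 0 ∧ b.2.2 ≠ 0 ∧
      (∀ l ∈ L, pairing (N l) a ≠ 0 ∧ pairing (N l) b ≠ 0) ∧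
      ∀ i, ∃ A ⊆ colorClass L color i, A.card = n ∧ ∀ l ∈ colorClass L color i,
        (l ∈ A → 0 < pairing (N l) a * pairing (N l) b) ∧
        (l ∉ A → pairing (N l) a * pairing (N l) b < 0) := by
  classical
  obtain ⟨ε, hε, hsign⟩ := exists_uniform_pos_mul_pairing hdet hN hL
  obtain ⟨a, b, ha, hb, hab⟩ := exists_correlation_lt_one continuous_truncation
    (monotone_truncation hε) truncation_neg abs_truncation_le (exists_truncation_eq_mul hε)
    N (colorClass L color)
  choose A hAS hAn hA using fun i ↦ Finset.exists_half_of_abs_sum_lt_one (hcard i)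
    (c := fun l ↦ truncation ε (pairing (N l) a) * truncation ε (pairing (N l) b))
    (fun l _ ↦ by
      rw [abs_mul]
      exact mul_le_one₀ (abs_truncation_le _) (abs_nonneg _) (abs_truncation_le _)) (hab i)
  obtain ⟨σ, hσ⟩ : ∃ σ : ι → ℝ, ∀ l, σ l = if l ∈ A (color l) then 1 else -1 := ⟨_, fun _ ↦ rfl⟩
  have hσ1 : ∀ l, σ l = 1 ∨ σ l = -1 := fun l ↦ by rw [hσ]; split_ifs <;> simp
  have hσt : ∀ l ∈ L, ε ≤ |pairing (N l) a| → ε ≤ |pairing (N l) b| →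
      σ l = truncation ε (pairing (N l) a) * truncation ε (pairing (N l) b) := by
    intro l hl h₁ h₂
    have h₃ := hA (color l) l (by simp [colorClass, hl])
    rw [hσ]
    rcases truncation_of_le_abs hε h₁ with ⟨h₁, -⟩ | ⟨h₁, -⟩ <;>
      rcases truncation_of_le_abs hε h₂ with ⟨h₂, -⟩ | ⟨h₂, -⟩ <;>
      simp only [h₁, h₂] at h₃ ⊢ <;> norm_num at h₃ ⊢ <;> simp [h₃]
  -- `σ` is the desired sign of the product, `τ` that of the form at `b`, and `σ * τ` that at `a`.
  -- The cases make both agree with every form of size at least `ε`.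
  obtain ⟨τ, hτ⟩ : ∃ τ : ι → ℝ, ∀ l, τ l =
      if ε ≤ |pairing (N l) b| then truncation ε (pairing (N l) b) else
      if ε ≤ |pairing (N l) a| then σ l * truncation ε (pairing (N l) a) else 1 :=
    ⟨_, fun _ ↦ rfl⟩
  have hτ0 : ∀ l, τ l ≠ 0 := by
    intro l
    rw [hτ]
    split_ifs with h₁ h₂
    · rcases truncation_of_le_abs hε h₁ with ⟨h, -⟩ | ⟨h, -⟩ <;> simp [h]
    · rcases truncation_of_le_abs hε h₂ with ⟨h, -⟩ | ⟨h, -⟩ <;>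
        rcases hσ1 l with h' | h' <;> simp [h, h']
    · exact one_ne_zero
  have hσ0 : ∀ l, σ l ≠ 0 := fun l ↦ by rcases hσ1 l with h | h <;> simp [h]
  have hpos : ∀ s, ε ≤ |s| → 0 < truncation ε s * s := by
    intro s hs
    rcases truncation_of_le_abs hε hs with ⟨h, h'⟩ | ⟨h, h'⟩ <;> rw [h] <;> linarith
  have hsq : ∀ s, ε ≤ |s| → truncation ε s * truncation ε s = 1 := by
    intro s hs
    rcases truncation_of_le_abs hε hs with ⟨h, h'⟩ | ⟨h, h'⟩ <;> rw [h] <;> norm_num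
  obtain ⟨b', hb'z, hb'⟩ := hsign b hb τ (fun l _ ↦ hτ0 l) (fun l _ h ↦ by
    rw [hτ, if_pos h]
    exact hpos _ h)
  obtain ⟨a', ha'z, ha'⟩ := hsign a ha (fun l ↦ σ l * τ l)
    (fun l _ ↦ mul_ne_zero (hσ0 l) (hτ0 l)) (fun l hl h ↦ by
      have h₀ := hpos _ h
      by_cases h' : ε ≤ |pairing (N l) b|
      · rw [hτ, if_pos h', hσt l hl h h', mul_assoc (truncation ε _), hsq _ h', mul_one]
        exact h₀
      · have : σ l * σ l = 1 := by rcases hσ1 l with h | h <;> rw [h] <;> norm_num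
        rw [hτ, if_neg h', if_pos h, ← mul_assoc (σ l), this, one_mul]
        exact h₀)
  have hprod : ∀ l ∈ L, 0 < σ l * (pairing (N l) a' * pairing (N l) b') := by
    intro l hl
    have h : 0 < σ l * (pairing (N l) a' * pairing (N l) b') * τ l ^ 2 := by
      calc _ < _ := mul_pos (ha' l hl) (hb' l hl)
        _ = _ := by ring
    exact pos_of_mul_pos_left h (sq_nonneg _)
  refine ⟨a', b', ha'z, hb'z, fun l hl ↦ ⟨right_ne_zero_of_mul (ha' l hl).ne',
    right_ne_zero_of_mul (hb' l hl).ne'⟩, fun i ↦ ⟨A i, hAS i, hAn i, fun l hl ↦ ?_⟩⟩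
  obtain ⟨hlL, rfl⟩ := Finset.mem_filter.1 hl
  have h := hprod l hlL
  rw [hσ] at h
  constructor <;> intro h' <;> simp only [h', if_true, if_false] at h <;> linarith

/-! ### From lines in the plane to linear forms. -/

theorem IsLine.ne_bot {l : AffineSubspace ℝ Plane} (hl : IsLine l) : l ≠ ⊥ := by
  rintro rfl
  rw [IsLine, AffineSubspace.direction_bot, finrank_bot] at hl
  exact zero_ne_one hl

/-- Equation of a line. -/
theorem IsLine.exists_equation {l : AffineSubspace ℝ Plane} (hl : IsLine l) :
    ∃ n : ℝ × ℝ × ℝ, n.1 ^ 2 + n.2.1 ^ 2 ≠ 0 ∧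
      (∀ p : Plane, p ∈ l ↔ pairing n (p 0, p 1, 1) = 0) ∧
      ∀ w : Plane, w ∈ l.direction ↔ n.1 * w 0 + n.2.1 * w 1 = 0 := by
  obtain ⟨p, hp⟩ := (AffineSubspace.nonempty_iff_ne_bot l).2 hl.ne_bot
  obtain ⟨⟨v, hv⟩, hv0, hspan⟩ := finrank_eq_one_iff'.1 hl
  have hn : v 1 ^ 2 + v 0 ^ 2 ≠ 0 := by
    intro h
    refine hv0 (Subtype.ext (PiLp.ext fun i ↦ ?_))
    fin_cases i
    · exact pow_eq_zero_iff two_ne_zero |>.1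
        (show v 0 ^ 2 = 0 by nlinarith [sq_nonneg (v 0), sq_nonneg (v 1)])
    · exact pow_eq_zero_iff two_ne_zero |>.1
        (show v 1 ^ 2 = 0 by nlinarith [sq_nonneg (v 0), sq_nonneg (v 1)])
  have hdir : ∀ w : Plane, w ∈ l.direction ↔ -v 1 * w 0 + v 0 * w 1 = 0 := by
    intro w
    constructor
    · intro hw
      obtain ⟨c, hc⟩ := hspan ⟨w, hw⟩
      have hc : c • v = w := congrArg Subtype.val hc
      rw [← hc]
      simp only [PiLp.smul_apply, smul_eq_mul]
      ring
    · intro hw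
      have : w = ((v 0 * w 0 + v 1 * w 1) / (v 1 ^ 2 + v 0 ^ 2)) • v := by
        ext i
        fin_cases i
        · simp only [Fin.zero_eta, PiLp.smul_apply, smul_eq_mul]
          field_simp
          linear_combination (-v 1) * hw
        · simp only [Fin.mk_one, PiLp.smul_apply, smul_eq_mul]
          field_simp
          linear_combination (v 0) * hw
      rw [this]
      exact Submodule.smul_mem _ _ hv
  refine ⟨(-v 1, v 0, v 1 * p 0 - v 0 * p 1), by simpa using hn, fun q ↦ ?_, hdir⟩
  rw [← AffineSubspace.vsub_right_mem_direction_iff_mem hp, hdir]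
  simp only [pairing, vsub_eq_sub, PiLp.sub_apply]
  constructor <;> intro h <;> linarith

theorem inter_segment_nonempty_iff {l : AffineSubspace ℝ Plane} {n : ℝ × ℝ × ℝ}
    (hn : ∀ p : Plane, p ∈ l ↔ pairing n (p 0, p 1, 1) = 0) {a b : Plane}
    (ha : a ∉ l) (hb : b ∉ l) :
    ((l : Set Plane) ∩ segment ℝ a b).Nonempty ↔
      pairing n (a 0, a 1, 1) * pairing n (b 0, b 1, 1) < 0 := by
  rw [hn] at ha hb
  have hcomb : ∀ s t : ℝ, s + t = 1 →
      pairing n ((s • a + t • b) 0, (s • a + t • b) 1, 1) =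
        s * pairing n (a 0, a 1, 1) + t * pairing n (b 0, b 1, 1) := by
    intro s t h
    simp only [pairing, PiLp.add_apply, PiLp.smul_apply, smul_eq_mul]
    linear_combination (-n.2.2) * h
  set x := pairing n (a 0, a 1, 1)
  set y := pairing n (b 0, b 1, 1)
  constructor
  · rintro ⟨p, hp, s, t, hs, ht, hst, rfl⟩
    have hp : s • a + t • b ∈ l := hp
    rw [hn, hcomb s t hst] at hp
    by_contra hxy
    have hxy : 0 < x * y := lt_of_le_of_ne (not_lt.1 hxy) (mul_ne_zero ha hb).symm
    have h₁ : s * x ^ 2 + t * (x * y) = 0 := by linear_combination x * hp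
    have h₂ : 0 < x ^ 2 := by positivity
    rcases hs.eq_or_lt with h | h
    · have : t = 1 := by linarith
      rw [← h, this] at h₁
      linarith
    · nlinarith [mul_pos h h₂, mul_nonneg ht hxy.le]
  · intro hxy
    have hne : x - y ≠ 0 := by
      intro h
      rw [sub_eq_zero.1 h] at hxy
      exact hxy.not_ge (mul_self_nonneg y)
    have h2 : 0 < (x - y) ^ 2 := by positivity
    refine ⟨(-y / (x - y)) • a + (x / (x - y)) • b, ?_, _, _, ?_, ?_, ?_, rfl⟩
    · change _ ∈ l
      rw [hn, hcomb _ _ (by field_simp; ring)]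
      field_simp
      ring
    · rw [show -y / (x - y) = (-y * (x - y)) / (x - y) ^ 2 by field_simp]
      exact div_nonneg (by nlinarith [sq_nonneg y]) h2.le
    · rw [show x / (x - y) = (x * (x - y)) / (x - y) ^ 2 by field_simp]
      exact div_nonneg (by nlinarith [sq_nonneg x]) h2.le
    · field_simp
      ring

theorem card_colorClass {α : Type*} {L : Finset α} {color : α → Fin 3} {n : ℕ}
    (hcard : L.card = 6 * n) (hbal : IsBalanced L color) (i : Fin 3) :
    (colorClass L color i).card = 2 * n := by
  have h := Finset.card_eq_sum_card_fiberwise (f := color) (s := L) (t := Finset.univ)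
    (fun _ _ ↦ Finset.mem_coe.2 (Finset.mem_univ _))
  change L.card = ∑ j, (colorClass L color j).card at h
  rw [Finset.sum_congr rfl fun j _ ↦ hbal j i, Finset.sum_const, Finset.card_univ,
    Fintype.card_fin, smul_eq_mul, hcard] at h
  omega

theorem mainTheorem8 (n : ℕ) (L : Finset (AffineSubspace ℝ Plane))
    (color : AffineSubspace ℝ Plane → Fin 3)
    (hsimple : IsSimpleArrangement L)
    (hcard : L.card = 6 * n)
    (hbal : IsBalanced L color) :
    ∃ a b : Plane, a ≠ b ∧
      (∀ l ∈ L, a ∉ l ∧ b ∉ l) ∧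
      ∀ i : Fin 3,
        {l : AffineSubspace ℝ Plane | l ∈ colorClass L color i ∧
          ((l : Set Plane) ∩ segment ℝ a b).Nonempty}.ncard = n := by
  classical
  obtain ⟨hline, hpar, hpt⟩ := hsimple
  have hclass := card_colorClass hcard hbal
  rcases Nat.eq_zero_or_pos n with rfl | hn
  · rw [mul_zero, Finset.card_eq_zero] at hcard
    subst hcard
    refine ⟨0, EuclideanSpace.single 0 1, fun h ↦ ?_, by simp, by simp [colorClass]⟩
    have := congrArg (fun v : Plane ↦ v 0) h
    simp at this
  choose! N hN0 hN hNdir using fun l hl ↦ (hline l hl).exists_equation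
  have hdet : ∀ l ∈ L, ∀ m ∈ L, l ≠ m → (N l).1 * (N m).2.1 - (N m).1 * (N l).2.1 ≠ 0 := by
    intro l hl m hm hlm h
    refine hpar l hl m hm hlm
      (AffineSubspace.parallel_iff_direction_eq_and_eq_bot_iff_eq_bot.2 ⟨?_, ?_⟩)
    · ext w
      rw [hNdir l hl, hNdir m hm]
      constructor <;> intro hw
      · refine (mul_eq_zero_iff_left (hN0 l hl)).1 ?_
        linear_combination ((N l).1 * (N m).1 + (N l).2.1 * (N m).2.1) * hw
          + ((N l).1 * w 1 - (N l).2.1 * w 0) * h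
      · refine (mul_eq_zero_iff_left (hN0 m hm)).1 ?_
        linear_combination ((N l).1 * (N m).1 + (N l).2.1 * (N m).2.1) * hw
          - ((N m).1 * w 1 - (N m).2.1 * w 0) * h
    · simp [(hline l hl).ne_bot, (hline m hm).ne_bot]
  have hcount : ∀ v, v ≠ 0 → (L.filter fun l ↦ pairing (N l) v = 0).card ≤ 2 := by
    rintro ⟨x, y, z⟩ hv
    -- A point at infinity lies on at most one line, since no two are parallel.
    by_cases hz : z = 0
    · refine le_trans (Finset.card_le_one.2 fun l hl m hm ↦ ?_) one_le_two
      obtain ⟨hl, hlv⟩ := Finset.mem_filter.1 hl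
      obtain ⟨hm, hmv⟩ := Finset.mem_filter.1 hm
      by_contra hlm
      have hd := hdet l hl m hm hlm
      simp only [pairing, hz, mul_zero, add_zero] at hlv hmv
      refine hv ?_
      rw [hz, (mul_eq_zero_iff_left hd).1 (show _ * x = 0 by
        linear_combination (N m).2.1 * hlv - (N l).2.1 * hmv),
        (mul_eq_zero_iff_left hd).1 (show _ * y = 0 by
        linear_combination (N l).1 * hmv - (N m).1 * hlv)]
      rfl
    · refine le_trans (le_of_eq ?_) (hpt !₂[x / z, y / z])
      rw [← Set.ncard_coe_finset]
      congr 1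
      ext l
      simp only [Finset.coe_filter, Set.mem_ofPred_eq]
      refine and_congr_right fun hl ↦ ?_
      rw [hN l hl]
      have : pairing (N l) (x, y, z) = z * pairing (N l) (x / z, y / z, 1) := by
        simp only [pairing]
        field_simp
      rw [this, mul_eq_zero_iff_left hz]
      simp
  obtain ⟨u, v, hu, hv, huv, hhalf⟩ := exists_half_neg_pairing color hclass hdet hN0 hcount
  obtain ⟨a, ha⟩ : ∃ a : Plane, ∀ l, pairing (N l) (a 0, a 1, 1) = u.2.2⁻¹ * pairing (N l) u :=
    ⟨!₂[u.1 / u.2.2, u.2.1 / u.2.2], fun l ↦ by simp [pairing]; field_simp⟩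
  obtain ⟨b, hb⟩ : ∃ b : Plane, ∀ l, pairing (N l) (b 0, b 1, 1) = v.2.2⁻¹ * pairing (N l) v :=
    ⟨!₂[v.1 / v.2.2, v.2.1 / v.2.2], fun l ↦ by simp [pairing]; field_simp⟩
  have hal : ∀ l ∈ L, a ∉ l := fun l hl ↦ by
    rw [hN l hl, ha]; exact mul_ne_zero (inv_ne_zero hu) (huv l hl).1
  have hbl : ∀ l ∈ L, b ∉ l := fun l hl ↦ by
    rw [hN l hl, hb]; exact mul_ne_zero (inv_ne_zero hv) (huv l hl).2
  have hncard : ∀ i : Fin 3, {l : AffineSubspace ℝ Plane | l ∈ colorClass L color i ∧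
      ((l : Set Plane) ∩ segment ℝ a b).Nonempty}.ncard = n := by
    intro i
    obtain ⟨A, hAS, hAn, hA⟩ := hhalf i
    have hmem : ∀ l ∈ colorClass L color i, (((l : Set Plane) ∩ segment ℝ a b).Nonempty ↔
        (u.2.2⁻¹ * v.2.2⁻¹) * (pairing (N l) u * pairing (N l) v) < 0) := by
      intro l hl
      have hl := (Finset.mem_filter.1 hl).1
      rw [inter_segment_nonempty_iff (hN l hl) (hal l hl) (hbl l hl), ha, hb, mul_mul_mul_comm]
    -- Dehomogenizing multiplies the product of values by this factor; if it is negative, the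
    -- segment meets `A` instead of its complement, also of size `n`.
    rcases (mul_ne_zero (inv_ne_zero hu) (inv_ne_zero hv)).lt_or_gt with hneg | hpos
    · rw [← hAn, ← Set.ncard_coe_finset]
      congr 1
      ext l
      constructor
      · rintro ⟨hl, h⟩
        rw [hmem l hl] at h
        by_contra hlA
        exact lt_asymm h (mul_pos_of_neg_of_neg hneg ((hA l hl).2 hlA))
      · intro hlA
        have hl := hAS hlA
        exact ⟨hl, (hmem l hl).2 (mul_neg_of_neg_of_pos hneg ((hA l hl).1 hlA))⟩
    · have hc : (colorClass L color i \ A).card = n := by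
        rw [Finset.card_sdiff_of_subset hAS, hclass, hAn]
        omega
      rw [← hc, ← Set.ncard_coe_finset]
      congr 1
      ext l
      rw [Finset.mem_coe, Finset.mem_sdiff]
      refine and_congr_right fun hl ↦ ?_
      rw [hmem l hl]
      constructor
      · intro h hlA
        exact lt_asymm h (mul_pos hpos ((hA l hl).1 hlA))
      · intro hlA
        exact mul_neg_of_pos_of_neg hpos ((hA l hl).2 hlA)
  refine ⟨a, b, ?_, fun l hl ↦ ⟨hal l hl, hbl l hl⟩, hncard⟩
  -- A degenerate segment would meet no line, but `n > 0`.
  rintro rfl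
  have hempty : {l : AffineSubspace ℝ Plane | l ∈ colorClass L color 0 ∧
      ((l : Set Plane) ∩ segment ℝ a a).Nonempty} = ∅ := by
    ext l
    simp only [Set.mem_ofPred_eq, Set.mem_empty_iff_false, iff_false, not_and, segment_same]
    rintro hl ⟨p, hp, hpa⟩
    rw [Set.mem_singleton_iff.1 hpa] at hp
    exact hal l (Finset.mem_filter.1 hl).1 hp
  have h := hncard 0
  rw [hempty, Set.ncard_empty] at h
  omega
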